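/- **Theorem.** Let $H$ be a separable infinite-dimensional complex Hilbert space. For $M=\mathbb{R}_{+}=[0,\infty)$ (continuous time) and $M=\mathbb{N}_{0}$ (discrete time, discrete topology) let $\mathcal{C}_s(M)$ be the set of contractive $C_0$-semigroups over $H$ on $M$, that is, of maps $T$ from $M$ to the bounded linear operators on $H$ with $T(0)=I$, $T(s+t)=T(s)T(t)$ and $\|T(t)\|\le 1$ for all $s,t\in M$, and with $t\mapsto T(t)\xi$ continuous for every $\xi\in H$. Endow $\mathcal{C}_s(M)$ with the topology of uniform weak operator convergence on compact sets, in which a net $(T_i)$ converges to $T$ if and only if $\sup_{t\in K}|\langle (T_i(t)-T(t))\xi,\eta\rangle|\to 0$ for all $\xi,\eta\in H$ and all compact $K\subseteq M$. Then: 1. $\mathcal{C}_s(\mathbb{R}_{+})$ and $\mathcal{C}_s(\mathbb{N}_{0})$ are Baire spaces. 2. $\mathcal{C}_s(\mathbb{R}_{+})$ and $\mathcal{C}_s(\mathbb{N}_{0})$ are Choquet spaces: Player II has a winning strategy in the game in which Players I and II alternately choose non-empty open sets $U_0\supseteq V_0\supseteq U_1\supseteq V_1\supseteq\cdots$ (Player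 I the $U_n$, Player II the $V_n$), and Player II wins if and only if $\bigcap_n U_n\neq\emptyset$. 3. The set of contractions $\{T : \|T\|\le 1\}$ on $H$ is a Baire space under the weak polynomial (PW) topology, in which $T_i\to T$ if and only if $T_i^n\to T^n$ in the weak operator topology for all $n\in\mathbb{N}$. -/

import Mathlib

open Filter Topology
open scoped NNReal

/-- A contractive `C₀`-semigroup over `H` on an additive topological monoid `M`: a map from `M` to
the contractions of `H`, with `T(0) = I` and `T(s + t) = T(s)T(t)`, continuous for the strong
operator topology. The continuous-time semigroups are those with `M = ℝ≥0`, the discrete-time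
ones are those with `M = ℕ`. -/
@[ext]
structure ContractiveSemigroup (M H : Type*) [AddMonoid M] [TopologicalSpace M]
    [NormedAddCommGroup H] [InnerProductSpace ℂ H] where
  toFun : M → H →L[ℂ] H
  map_zero : toFun 0 = 1
  map_add : ∀ s t : M, toFun (s + t) = toFun s * toFun t
  norm_le_one : ∀ t : M, ‖toFun t‖ ≤ 1
  strongly_continuous : ∀ ξ : H, Continuous fun t : M => toFun t ξ

namespace ContractiveSemigroup

variable {M H : Type*} [AddMonoid M] [TopologicalSpace M]
  [NormedAddCommGroup H] [InnerProductSpace ℂ H]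

attribute [local instance 1100] InnerProductSpace.toInner

/-- The function `t ↦ ⟨T(t)ξ, η⟩` (Mathlib's inner product is linear in its second argument). -/
noncomputable def coeff (T : ContractiveSemigroup M H) (ξ η : H) : C(M, ℂ) where
  toFun t := inner ℂ η (T.toFun t ξ)
  continuous_toFun := continuous_const.inner (T.strongly_continuous ξ)

/-- The topology of uniform convergence in the weak operator topology on compact subsets of `M`.
The space `C(M, ℂ)` carries the compact-open topology, that is, the topology of uniform convergence
on compact sets. See `tendsto_nhds_iff` for the description of convergence. -/
noncomputable instance : TopologicalSpace (ContractiveSemigroup M H) :=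
  TopologicalSpace.induced (fun T (p : H × H) => T.coeff p.1 p.2) inferInstance

/-- `T i → T` if and only if `sup_{t ∈ K} |⟨(T i (t) - T(t))ξ, η⟩| → 0` for all vectors `ξ`, `η` and
all compact `K`. -/
theorem tendsto_nhds_iff {ι : Type*} {l : Filter ι} {T : ι → ContractiveSemigroup M H}
    {T₀ : ContractiveSemigroup M H} :
    Tendsto T l (𝓝 T₀) ↔ ∀ ξ η : H, ∀ K : Set M, IsCompact K → ∀ ε : ℝ, 0 < ε →
      ∀ᶠ i in l, ∀ t ∈ K, ‖inner ℂ η (((T i).toFun t - T₀.toFun t) ξ)‖ < ε := by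
  rw [nhds_induced, tendsto_comap_iff, tendsto_pi_nhds, Prod.forall]
  simp only [Function.comp_def, ContinuousMap.tendsto_iff_forall_isCompact_tendstoUniformlyOn,
    Metric.tendstoUniformlyOn_iff, coeff, ContinuousMap.coe_mk, sub_apply, inner_sub_right]
  simp only [dist_comm (inner ℂ _ ((T₀.toFun _) _)), dist_eq_norm]

end ContractiveSemigroup

/-- The weak polynomial topology on the bounded operators on `H`: the coarsest topology for which
all the power maps `T ↦ Tⁿ` are continuous into the weak operator topology. -/
@[reducible]
noncomputable def weakPolynomialTopology (H : Type*) [NormedAddCommGroup H] [InnerProductSpace ℂ H] :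
    TopologicalSpace (H →L[ℂ] H) :=
  TopologicalSpace.induced
    (fun T (n : ℕ) => (ContinuousLinearMapWOT.ofCLM (T ^ n) : H →WOT[ℂ] H)) inferInstance

theorem tendsto_weakPolynomialTopology_iff {H : Type*} [NormedAddCommGroup H]
    [InnerProductSpace ℂ H] {ι : Type*} {l : Filter ι} {T : ι → H →L[ℂ] H} {T₀ : H →L[ℂ] H} :
    Tendsto T l (@nhds _ (weakPolynomialTopology H) T₀) ↔
      ∀ n : ℕ, Tendsto (fun i => (ContinuousLinearMapWOT.ofCLM (T i ^ n) : H →WOT[ℂ] H)) l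
        (𝓝 (ContinuousLinearMapWOT.ofCLM (T₀ ^ n))) := by
  rw [weakPolynomialTopology, nhds_induced, tendsto_comap_iff, tendsto_pi_nhds]
  rfl

/-- The contractions of `H`, to be endowed with the weak polynomial topology. -/
@[ext]
structure PWContraction (H : Type*) [NormedAddCommGroup H] [InnerProductSpace ℂ H] where
  toCLM : H →L[ℂ] H
  norm_le_one : ‖toCLM‖ ≤ 1

noncomputable instance (H : Type*) [NormedAddCommGroup H] [InnerProductSpace ℂ H] :
    TopologicalSpace (PWContraction H) :=
  (weakPolynomialTopology H).induced PWContraction.toCLM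

namespace ChoquetGame

variable {X : Type*} [TopologicalSpace X]

/-- `U₀ ⊇ V₀ ⊇ U₁ ⊇ V₁ ⊇ ⋯ ⊇ Uₙ` and these are all non-empty and open, that is,
`(U₀, V₀, …, Vₙ₋₁, Uₙ)` is a valid position before the `n`-th move of Player II. Only the values
`U i` with `i ≤ n` and `V i` with `i < n` are restricted. -/
def ValidPosition (U V : ℕ → Set X) (n : ℕ) : Prop :=
  (∀ i ≤ n, IsOpen (U i) ∧ (U i).Nonempty) ∧
  (∀ i < n, IsOpen (V i) ∧ (V i).Nonempty ∧ V i ⊆ U i ∧ U (i + 1) ⊆ V i)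

/-- An infinite run `U₀ ⊇ V₀ ⊇ U₁ ⊇ V₁ ⊇ ⋯` of non-empty open sets. -/
def ValidRun (U V : ℕ → Set X) : Prop := ∀ n, ValidPosition U V n

/-- A strategy for Player II: a choice of `Vₙ` that depends on `(U₀, …, Uₙ)` and
`(V₀, …, Vₙ₋₁)`. -/
abbrev Strategy (X : Type*) : Type _ :=
  (n : ℕ) → (Fin (n + 1) → Set X) → (Fin n → Set X) → Set X

/-- The answer of the strategy `σ` to the position `(U₀, V₀, …, Vₙ₋₁, Uₙ)`. -/
def Strategy.answer (σ : Strategy X) (U V : ℕ → Set X) (n : ℕ) : Set X :=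
  σ n (fun i => U i) (fun i => V i)

/-- `σ` is a winning strategy for Player II: it answers every valid position by a legal move, and
each valid run in which Player II follows `σ` has `⋂ Uₙ ≠ ∅`. -/
def Strategy.IsWinning (σ : Strategy X) : Prop :=
  (∀ (U V : ℕ → Set X) (n : ℕ), ValidPosition U V n →
    IsOpen (σ.answer U V n) ∧ (σ.answer U V n).Nonempty ∧ σ.answer U V n ⊆ U n) ∧
  (∀ U V : ℕ → Set X, ValidRun U V → (∀ n, V n = σ.answer U V n) → (⋂ n, U n).Nonempty)

end ChoquetGame

/-- A Choquet space: Player II has a winning strategy in the Choquet game. -/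
def IsChoquetSpace (X : Type*) [TopologicalSpace X] : Prop :=
  ∃ σ : ChoquetGame.Strategy X, σ.IsWinning

/-! The isometric semigroups form a dense, completely metrizable subspace. Both the Baire property
and a winning strategy for Player II pass from such a subspace to the whole space.

Complete metrizability: between isometries, weak convergence to an isometry is already strong, so
the topology is that of uniform convergence of orbits on compact sets. The orbits of a dense
sequence of vectors embed the isometric semigroups as a closed subset of a countable product of
spaces `C(M, H)` (`isClosed_range_isometricOrbits`).

Density: the kernel `T(s - t)* T(t - s)` is positive definite (`norm_sq_sum_le`), and translation on
its reproducing kernel space is an isometric dilation `W` of `T`, with embedding `J`. As `H` is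
infinite-dimensional and everything is separable, `J` agrees with a unitary on any finite set of
vectors. Conjugating `W` by such unitaries gives isometric semigroups on `H` converging weakly to
`T`.

Part 3 is the discrete case of part 1, transported along `T ↦ T(1)`. -/

/-! ### Baire and Choquet properties from a dense subspace -/

/-- A space containing the inducing image of a Baire space as a dense subspace is a Baire space. -/
theorem Topology.IsInducing.baireSpace_of_denseRange {Z X : Type*} [TopologicalSpace Z]
    [TopologicalSpace X] [BaireSpace Z] {f : Z → X} (hf : IsInducing f) (hd : DenseRange f) :
    BaireSpace X where
  baire_property g ho hg := by
    have key : Dense (⋂ n, f ⁻¹' g n) := by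
      refine dense_iInter_of_isOpen (fun n => (ho n).preimage hf.continuous) fun n => ?_
      rw [dense_iff_inter_open]
      intro U hU hUne
      obtain ⟨V, hV, rfl⟩ := hf.isOpen_iff.1 hU
      obtain ⟨z, hz⟩ := hUne
      have hne : (V ∩ g n).Nonempty := (hg n).inter_open_nonempty V hV ⟨f z, hz⟩
      obtain ⟨w, hw⟩ := hd.exists_mem_open (hV.inter (ho n)) hne
      exact ⟨w, hw⟩
    refine (hd.dense_image hf.continuous key).mono ?_
    rintro _ ⟨z, hz, rfl⟩
    simpa using hz

open ChoquetGame in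
/-- A space containing the inducing image of a completely pseudometrizable space as a dense subspace
is a Choquet space: Player II answers by open sets that have small trace on the dense subspace. -/
theorem Topology.IsInducing.isChoquetSpace_of_denseRange {Z X : Type*} [TopologicalSpace Z]
    [TopologicalSpace X] [TopologicalSpace.IsCompletelyPseudoMetrizableSpace Z] {f : Z → X}
    (hf : IsInducing f) (hd : DenseRange f) : IsChoquetSpace X := by
  let := TopologicalSpace.upgradeIsCompletelyPseudoMetrizable Z
  have step : ∀ (n : ℕ) (U : Set X), ∃ V : Set X, IsOpen U → U.Nonempty →
      IsOpen V ∧ V.Nonempty ∧ V ⊆ U ∧ closure (f ⁻¹' V) ⊆ f ⁻¹' U ∧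
        ∀ x ∈ f ⁻¹' V, ∀ y ∈ f ⁻¹' V, dist x y ≤ (1 / 2 : ℝ) ^ n := by
    intro n U
    by_cases h : IsOpen U ∧ U.Nonempty
    · obtain ⟨hU, hne⟩ := h
      obtain ⟨z, hz⟩ := hd.exists_mem_open hU hne
      obtain ⟨r, hr, hrU⟩ := Metric.isOpen_iff.1 (hU.preimage hf.continuous) z hz
      have hn : (0 : ℝ) < (1 / 2 : ℝ) ^ n := by positivity
      -- The bound `r / 2` keeps the closed `ε`-ball inside the `r`-ball; the other bound makes the
      -- diameter at most `(1/2)^n`.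
      set ε := min (r / 2) ((1 / 2 : ℝ) ^ n / 2) with hε
      have hε0 : 0 < ε := by positivity
      obtain ⟨V, hV, hVe⟩ := hf.isOpen_iff.1 (Metric.isOpen_ball (x := z) (ε := ε))
      have hsub : f ⁻¹' (V ∩ U) ⊆ Metric.ball z ε := by
        rw [← hVe]; exact fun x hx => hx.1
      refine ⟨V ∩ U, fun _ _ => ⟨hV.inter hU, ⟨f z, ?_, hz⟩, Set.inter_subset_right, ?_, ?_⟩⟩
      · have : z ∈ f ⁻¹' V := by rw [hVe]; exact Metric.mem_ball_self hε0
        exact this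
      · refine ((closure_mono hsub).trans Metric.closure_ball_subset_closedBall).trans
          (Set.Subset.trans ?_ hrU)
        exact Metric.closedBall_subset_ball ((min_le_left _ _).trans_lt (by linarith))
      · intro x hx y hy
        have h1 := Metric.mem_ball.1 (hsub hx)
        have h2 := Metric.mem_ball.1 (hsub hy)
        have h3 : ε ≤ (1 / 2 : ℝ) ^ n / 2 := min_le_right _ _
        linarith [dist_triangle_right x y z]
    · exact ⟨∅, fun h1 h2 => absurd ⟨h1, h2⟩ h⟩
  choose F hF using step
  -- The strategy uses only the round number and the last move of Player I.
  refine ⟨fun n U _ => F n (U (Fin.last n)), fun U V n h => ?_, fun U V h hV => ?_⟩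
  · obtain ⟨ho, hne⟩ := h.1 n le_rfl
    have := hF n (U n) ho hne
    simpa [Strategy.answer] using ⟨this.1, this.2.1, this.2.2.1⟩
  · have hV' : ∀ n, V n = F n (U n) := fun n => by simpa [Strategy.answer] using hV n
    have hU : ∀ n, IsOpen (U n) ∧ (U n).Nonempty := fun n => (h n).1 n le_rfl
    have hP := fun n => hF n (U n) (hU n).1 (hU n).2
    simp only [← hV'] at hP
    have hanti : Antitone V := antitone_nat_of_succ_le fun n =>
      (hP (n + 1)).2.2.1.trans ((h (n + 1)).2 n n.lt_succ_self).2.2.2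
    choose z hz using fun n => hd.exists_mem_open (hP n).1 (hP n).2.1
    have hmem : ∀ n m, n ≤ m → z m ∈ f ⁻¹' V n := fun n m hnm => hanti hnm (hz m)
    have hcau : CauchySeq z := by
      refine cauchySeq_of_le_tendsto_0 (fun n => (1 / 2 : ℝ) ^ n)
        (fun k m n hk hm => (hP n).2.2.2.2 _ (hmem n k hk) _ (hmem n m hm)) ?_
      exact tendsto_pow_atTop_nhds_zero_of_lt_one (by norm_num) (by norm_num)
    obtain ⟨w, hw⟩ := cauchySeq_tendsto_of_complete hcau
    refine ⟨f w, Set.mem_iInter.2 fun n => (hP n).2.2.2.1 ?_⟩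
    exact mem_closure_of_tendsto hw ((eventually_ge_atTop n).mono fun m hm => hmem n m hm)

/-! ### Isometric semigroups and their orbits -/

/-- For a family of `1`-Lipschitz maps, the points with a continuous orbit form a closed set. -/
theorem isClosed_setOf_continuous_apply {M X Y : Type*} [TopologicalSpace M] [PseudoMetricSpace X]
    [PseudoMetricSpace Y] {A : M → X → Y} (hA : ∀ t, LipschitzWith 1 (A t)) :
    IsClosed {x | Continuous fun t => A t x} := by
  refine isClosed_of_closure_subset fun x hx => continuous_of_uniform_approx_of_continuous ?_
  intro U hU
  obtain ⟨ε, hε, hεU⟩ := Metric.mem_uniformity_dist.1 hU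
  obtain ⟨y, hy, hxy⟩ := Metric.mem_closure_iff.1 hx ε hε
  refine ⟨fun t => A t y, hy, fun t => hεU ?_⟩
  exact ((hA t).dist_le_mul x y).trans_lt (by simpa using hxy)

namespace ContractiveSemigroup

section Orbits

variable {M H : Type*} [AddMonoid M] [TopologicalSpace M]
  [NormedAddCommGroup H] [InnerProductSpace ℂ H]

/-- The orbit `t ↦ T(t)ξ`. -/
def orbit (T : ContractiveSemigroup M H) (ξ : H) : C(M, H) where
  toFun t := T.toFun t ξ
  continuous_toFun := T.strongly_continuous ξ

@[simp]
theorem orbit_apply (T : ContractiveSemigroup M H) (ξ : H) (t : M) : T.orbit ξ t = T.toFun t ξ :=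
  rfl

theorem norm_apply_le (T : ContractiveSemigroup M H) (t : M) (ξ : H) : ‖T.toFun t ξ‖ ≤ ‖ξ‖ :=
  (T.toFun t).le_of_opNorm_le (T.norm_le_one t) ξ |>.trans_eq (one_mul _)

variable (M H) in
/-- The contractive semigroups that consist of isometries. -/
def isometric : Set (ContractiveSemigroup M H) := {T | ∀ t ξ, ‖T.toFun t ξ‖ = ‖ξ‖}

/-- All squared norms equal `‖ξ‖²`, so only the cross term is left: a strong distance is controlled
by a weak quantity. -/
theorem norm_sub_sq_of_isometric {A B : H →L[ℂ] H} (hA : ∀ ξ, ‖A ξ‖ = ‖ξ‖) (hB : ∀ ξ, ‖B ξ‖ = ‖ξ‖)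
    (ξ : H) : ‖A ξ - B ξ‖ ^ 2 = -2 * (inner ℂ (B ξ) ((A - B) ξ)).re := by
  have h1 := norm_sub_sq (𝕜 := ℂ) (A ξ) (B ξ)
  have h2 : (inner ℂ (B ξ) (B ξ)).re = ‖B ξ‖ ^ 2 := inner_self_eq_norm_sq (𝕜 := ℂ) (B ξ)
  rw [← inner_conj_symm, RCLike.conj_re] at h1
  rw [sub_apply, inner_sub_right, Complex.sub_re, h1, h2, hA, hB]
  simp only [RCLike.re_eq_complex_re]
  ring

/-- For isometric semigroups, weak convergence implies strong convergence. -/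
theorem tendsto_orbit_of_isometric {ι : Type*} {l : Filter ι} {T : ι → ContractiveSemigroup M H}
    {T₀ : ContractiveSemigroup M H} (hT : ∀ i, T i ∈ isometric M H) (hT₀ : T₀ ∈ isometric M H)
    (h : Tendsto T l (𝓝 T₀)) (ξ : H) : Tendsto (fun i => (T i).orbit ξ) l (𝓝 (T₀.orbit ξ)) := by
  rw [ContinuousMap.tendsto_iff_forall_isCompact_tendstoUniformlyOn]
  intro K hK
  rw [Metric.tendstoUniformlyOn_iff]
  intro ε hε
  obtain ⟨δ, hδ, hδε⟩ : ∃ δ > 0, 2 * (δ + δ * (2 * ‖ξ‖)) < ε ^ 2 := by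
    refine ⟨ε ^ 2 / (4 * (1 + 2 * ‖ξ‖)), by positivity, ?_⟩
    have : (0 : ℝ) < 1 + 2 * ‖ξ‖ := by positivity
    have e : 2 * (ε ^ 2 / (4 * (1 + 2 * ‖ξ‖)) + ε ^ 2 / (4 * (1 + 2 * ‖ξ‖)) * (2 * ‖ξ‖))
      = ε ^ 2 / 2 := by field_simp; ring
    rw [e]
    have : 0 < ε ^ 2 := by positivity
    linarith
  -- The test vector `T₀(t)ξ` moves with `t`, while weak convergence handles one fixed vector at a
  -- time. The orbit over `K` is compact, so a finite `δ`-net of test vectors suffices.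
  obtain ⟨F, -, hF, hcov⟩ :=
    (hK.image (T₀.strongly_continuous ξ)).finite_cover_balls hδ
  have hev : ∀ᶠ i in l, ∀ η ∈ F, ∀ t ∈ K, ‖inner ℂ η (((T i).toFun t - T₀.toFun t) ξ)‖ < δ :=
    (eventually_all_finite hF).2 fun η _ => tendsto_nhds_iff.1 h ξ η K hK δ hδ
  filter_upwards [hev] with i hi t ht
  obtain ⟨η, hη, hηt⟩ := Set.mem_iUnion₂.1 (hcov (Set.mem_image_of_mem _ ht))
  have hsq := norm_sub_sq_of_isometric (hT i t) (hT₀ t) ξ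
  set D := ((T i).toFun t - T₀.toFun t) ξ with hD
  have hDn : ‖D‖ ≤ 2 * ‖ξ‖ := by
    rw [hD, sub_apply, two_mul]
    exact (norm_sub_le _ _).trans (add_le_add (norm_apply_le _ _ _) (norm_apply_le _ _ _))
  have hin : ‖inner ℂ (T₀.toFun t ξ) D‖ ≤ δ + δ * (2 * ‖ξ‖) := by
    have e : inner ℂ (T₀.toFun t ξ) D = inner ℂ η D + inner ℂ (T₀.toFun t ξ - η) D := by
      rw [inner_sub_left]; ring
    rw [e]
    refine (norm_add_le _ _).trans (add_le_add (hi η hη t ht).le ?_)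
    refine (norm_inner_le_norm _ _).trans (mul_le_mul ?_ hDn (norm_nonneg _) hδ.le)
    exact (mem_ball_iff_norm.1 hηt).le
  have hre := (abs_le.1 ((Complex.abs_re_le_norm _).trans hin)).1
  rw [dist_eq_norm', orbit_apply, orbit_apply]
  refine lt_of_pow_lt_pow_left₀ 2 hε.le ?_
  linarith

/-- Strong convergence on a dense set of vectors implies weak convergence. -/
theorem tendsto_of_tendsto_orbit {ι κ : Type*} {l : Filter ι} {T : ι → ContractiveSemigroup M H}
    {T₀ : ContractiveSemigroup M H} {u : κ → H} (hu : DenseRange u)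
    (h : ∀ k, Tendsto (fun i => (T i).orbit (u k)) l (𝓝 (T₀.orbit (u k)))) :
    Tendsto T l (𝓝 T₀) := by
  rw [tendsto_nhds_iff]
  intro ξ η K hK ε hε
  have hη : 0 < 1 + ‖η‖ := by positivity
  -- Three error terms, each paired with `η`; the summand `1` covers `η = 0`.
  obtain ⟨k, hk⟩ := hu.exists_dist_lt ξ (ε := ε / (3 * (1 + ‖η‖))) (by positivity)
  have hk' := h k
  rw [ContinuousMap.tendsto_iff_forall_isCompact_tendstoUniformlyOn] at hk'
  filter_upwards [Metric.tendstoUniformlyOn_iff.1 (hk' K hK) (ε / (3 * (1 + ‖η‖))) (by positivity)]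
    with i hi t ht
  have h1 := hi t ht
  rw [dist_eq_norm', orbit_apply, orbit_apply] at h1
  rw [dist_eq_norm] at hk
  have e : ((T i).toFun t - T₀.toFun t) ξ = (T i).toFun t (ξ - u k)
      + ((T i).toFun t (u k) - T₀.toFun t (u k)) - T₀.toFun t (ξ - u k) := by
    simp only [sub_apply, map_sub]; abel
  have h2 : ‖((T i).toFun t - T₀.toFun t) ξ‖ < ε / (1 + ‖η‖) := by
    rw [e]
    have e2 : ε / (1 + ‖η‖) = 3 * (ε / (3 * (1 + ‖η‖))) := by field_simp
    refine (norm_sub_le _ _).trans_lt ?_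
    have := norm_add_le ((T i).toFun t (ξ - u k)) ((T i).toFun t (u k) - T₀.toFun t (u k))
    have := (T i).norm_apply_le t (ξ - u k)
    have := T₀.norm_apply_le t (ξ - u k)
    linarith
  calc _ ≤ ‖η‖ * ‖((T i).toFun t - T₀.toFun t) ξ‖ := norm_inner_le_norm _ _
    _ ≤ ‖η‖ * (ε / (1 + ‖η‖)) := by gcongr
    _ < (1 + ‖η‖) * (ε / (1 + ‖η‖)) := by gcongr; linarith
    _ = ε := by field_simp

/-- The orbits of an isometric semigroup that start in a given family of vectors. -/
def isometricOrbits {κ : Type*} (u : κ → H) (T : isometric M H) (k : κ) : C(M, H) :=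
  T.1.orbit (u k)

theorem isInducing_isometricOrbits {κ : Type*} {u : κ → H} (hu : DenseRange u) :
    IsInducing (isometricOrbits (M := M) u) := by
  rw [isInducing_iff_nhds]
  intro T
  apply le_antisymm
  · rw [← tendsto_iff_comap, tendsto_pi_nhds]
    intro k
    exact tendsto_orbit_of_isometric (fun S : isometric M H => S.2) T.2
      continuous_subtype_val.continuousAt (u k)
  · rw [← tendsto_id', tendsto_subtype_rng]
    refine tendsto_of_tendsto_orbit hu fun k => ?_
    exact tendsto_pi_nhds.1 (tendsto_comap (f := isometricOrbits (M := M) u)) k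

theorem injective_isometricOrbits {κ : Type*} {u : κ → H} (hu : DenseRange u) :
    Function.Injective (isometricOrbits (M := M) u) := by
  intro S T h
  refine Subtype.ext (ContractiveSemigroup.ext (funext fun t => ?_))
  refine ContinuousLinearMap.coeFn_injective (hu.equalizer (map_continuous _) (map_continuous _) ?_)
  exact funext fun k => DFunLike.congr_fun (congr_fun h k) t

/-- If isometries converge strongly on a dense set of vectors, they converge on every vector. -/
theorem tendsto_of_isometric_of_tendsto [CompleteSpace H] {ι κ : Type*} {l : Filter ι} [l.NeBot]
    {A : ι → H →L[ℂ] H} (hA : ∀ i ξ, ‖A i ξ‖ = ‖ξ‖) {u : κ → H} (hu : DenseRange u) {g : κ → H}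
    (h : ∀ k, Tendsto (fun i => A i (u k)) l (𝓝 (g k))) (ξ : H) :
    ∃ η, Tendsto (fun i => A i ξ) l (𝓝 η) := by
  rw [← cauchy_map_iff_exists_tendsto, Metric.cauchy_iff]
  refine ⟨inferInstance, fun ε hε => ?_⟩
  obtain ⟨k, hk⟩ := hu.exists_dist_lt ξ (ε := ε / 4) (by positivity)
  refine ⟨Metric.ball (g k) (ε / 2), ?_, fun x hx y hy => ?_⟩
  · rw [mem_map]
    filter_upwards [(h k).eventually (Metric.ball_mem_nhds (g k) (ε := ε / 4) (by positivity))]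
      with i hi
    have : dist (A i ξ) (A i (u k)) = dist ξ (u k) := by
      rw [dist_eq_norm, ← map_sub, hA, dist_eq_norm]
    have := dist_triangle (A i ξ) (A i (u k)) (g k)
    have hi' : dist (A i (u k)) (g k) < ε / 4 := hi
    exact Metric.mem_ball.2 (by linarith)
  · rw [Metric.mem_ball] at hx hy
    linarith [dist_triangle_right x y (g k)]

/-- At a limit `g` of orbit families, the operators converge strongly at each time, because
isometries converging on a dense set converge everywhere. The limits form an isometric semigroup
with orbits `g`. -/
theorem isClosed_range_isometricOrbits [CompleteSpace H] {κ : Type*} {u : κ → H}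
    (hu : DenseRange u) : IsClosed (Set.range (isometricOrbits (M := M) u)) := by
  refine isClosed_of_closure_subset fun g hg => ?_
  rw [mem_closure_iff_frequently, ← comap_neBot_iff_frequently] at hg
  set l := comap (isometricOrbits (M := M) u) (𝓝 g)
  have hl : ∀ k t, Tendsto (fun T : isometric M H => T.1.toFun t (u k)) l (𝓝 (g k t)) :=
    fun k t => ((continuous_eval_const t).tendsto _).comp
      (tendsto_pi_nhds.1 (tendsto_comap (f := isometricOrbits (M := M) u)) k)
  choose L hL using fun t ξ =>
    tendsto_of_isometric_of_tendsto (A := fun T : isometric M H => T.1.toFun t)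
      (fun T => T.2 t) hu (fun k => hl k t) ξ
  have hnorm : ∀ t ξ, ‖L t ξ‖ = ‖ξ‖ := fun t ξ =>
    tendsto_nhds_unique (hL t ξ).norm <| by
      simp only [(Subtype.prop _ : _ ∈ isometric M H) t ξ]
      exact tendsto_const_nhds
  have hadd : ∀ t ξ η, L t (ξ + η) = L t ξ + L t η := fun t ξ η =>
    tendsto_nhds_unique (hL t (ξ + η)) <| by
      simpa only [_root_.map_add] using (hL t ξ).add (hL t η)
  have hsmul : ∀ t (c : ℂ) ξ, L t (c • ξ) = c • L t ξ := fun t c ξ =>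
    tendsto_nhds_unique (hL t (c • ξ)) (by simpa only [map_smul] using (hL t ξ).const_smul c)
  let A : M → H →L[ℂ] H := fun t =>
    (LinearMap.mk ⟨L t, hadd t⟩ (hsmul t)).mkContinuous 1 fun ξ => by simp [hnorm]
  have hAu : ∀ t k, A t (u k) = g k t := fun t k => tendsto_nhds_unique (hL t (u k)) (hl k t)
  let T : ContractiveSemigroup M H :=
    { toFun := A
      map_zero := by
        ext ξ
        refine tendsto_nhds_unique (hL 0 ξ) ?_
        simp only [map_zero]
        exact tendsto_const_nhds
      map_add := fun s t => by
        ext ξ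
        refine tendsto_nhds_unique (hL (s + t) ξ) ?_
        -- Products pass to the strong limit because `T(s)` preserves the norm of the error `T(t)ξ -
        -- L t ξ`.
        have h1 : Tendsto (fun T : isometric M H => T.1.toFun s (T.1.toFun t ξ - L t ξ)) l (𝓝 0) := by
          rw [tendsto_zero_iff_norm_tendsto_zero]
          simp only [(Subtype.prop _ : _ ∈ isometric M H) s _]
          simpa using ((hL t ξ).sub_const (L t ξ)).norm
        have h2 := h1.add (hL s (L t ξ))
        simp only [map_sub, sub_add_cancel, zero_add] at h2
        simp only [map_add]
        exact h2
      norm_le_one := fun t => LinearMap.mkContinuous_norm_le _ zero_le_one _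
      strongly_continuous := fun ξ => by
        refine (isClosed_setOf_continuous_apply fun t => ?_).closure_subset_iff.2 ?_ (hu ξ)
        · exact (AddMonoidHomClass.isometry_of_norm (A t) (hnorm t)).lipschitz
        · rintro _ ⟨k, rfl⟩
          simpa only [Set.mem_ofPred_eq, hAu] using (g k).continuous }
  exact ⟨⟨T, hnorm⟩, funext fun k => ContinuousMap.ext fun t => hAu t k⟩

/-- Local compactness and σ-compactness of `M` make `C(M, H)` completely metrizable; separability of
`H` keeps the product countable. -/
theorem isCompletelyPseudoMetrizableSpace_isometric [CompleteSpace H]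
    [TopologicalSpace.SeparableSpace H] [WeaklyLocallyCompactSpace M] [SigmaCompactSpace M] :
    TopologicalSpace.IsCompletelyPseudoMetrizableSpace (isometric M H) := by
  have hu := TopologicalSpace.denseRange_denseSeq H
  exact Topology.IsClosedEmbedding.IsCompletelyPseudoMetrizableSpace
    (f := isometricOrbits (M := M) (TopologicalSpace.denseSeq H))
    ⟨⟨isInducing_isometricOrbits hu, injective_isometricOrbits hu⟩,
      isClosed_range_isometricOrbits hu⟩

end Orbits

end ContractiveSemigroup

/-! ### Isometric dilation -/

/-- Two families with the same Gram matrix, the first one with dense span, are related by an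
isometry. -/
theorem exists_isometry_of_inner_eq {ι K : Type*} [NormedAddCommGroup K] [InnerProductSpace ℂ K]
    [CompleteSpace K] {e e' : ι → K} (he : Dense (Submodule.span ℂ (Set.range e) : Set K))
    (h : ∀ i j, inner ℂ (e' i) (e' j) = inner ℂ (e i) (e j)) :
    ∃ W : K →L[ℂ] K, (∀ x, ‖W x‖ = ‖x‖) ∧ ∀ i, W (e i) = e' i := by
  set E := Finsupp.linearCombination ℂ e
  set E' := Finsupp.linearCombination ℂ e'
  have hE : DenseRange E := by
    rw [DenseRange, ← LinearMap.coe_range, Finsupp.range_linearCombination]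
    exact he
  have hnorm : ∀ f, ‖E' f‖ = ‖E f‖ := fun f => by
    rw [norm_eq_sqrt_re_inner (𝕜 := ℂ), norm_eq_sqrt_re_inner (𝕜 := ℂ)]
    simp only [E, E', Finsupp.linearCombination_apply, Finsupp.sum_inner, Finsupp.inner_sum,
      inner_smul_left, inner_smul_right, h]
  have hW : ∀ f, E'.extendOfNorm E (E f) = E' f := fun f =>
    LinearMap.extendOfNorm_eq hE ⟨1, fun f => by rw [hnorm, one_mul]⟩ f
  refine ⟨E'.extendOfNorm E, fun x => ?_, fun i => ?_⟩
  · refine hE.induction_on x (isClosed_eq (by fun_prop) (by fun_prop)) fun f => ?_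
    rw [hW, hnorm]
  · simpa [E, E'] using hW (Finsupp.single i 1)

namespace ContractiveSemigroup

section Dilation

variable {M H : Type*} [AddCommMonoid M] [Sub M] [TopologicalSpace M] [NormedAddCommGroup H]
  [InnerProductSpace ℂ H]

open ContinuousLinearMap in
/-- The kernel `K(s, t) = T(s - t)* T(t - s)` of the isometric dilation of a contractive semigroup,
where the differences are truncated. -/
noncomputable def dilationKernel [CompleteSpace H] (T : ContractiveSemigroup M H) :
    Matrix M M (H →L[ℂ] H) :=
  Matrix.of fun s t => adjoint (T.toFun (s - t)) ∘L T.toFun (t - s)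

theorem inner_dilationKernel [CompleteSpace H] (T : ContractiveSemigroup M H) (s t : M) (ξ η : H) :
    inner ℂ (T.dilationKernel s t ξ) η = inner ℂ (T.toFun (t - s) ξ) (T.toFun (s - t) η) := by
  simp [dilationKernel, ContinuousLinearMap.adjoint_inner_left]

variable [LinearOrder M] [CanonicallyOrderedAdd M]
  [IsOrderedCancelAddMonoid M] [OrderedSub M]

/-- Positive definiteness of the dilation kernel, strengthened for induction on the support: the
quadratic form dominates the squared norm of the compressed sum. -/
theorem norm_sq_sum_le (T : ContractiveSemigroup M H) (f : M → H) (s : Finset M) :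
    ∀ m : M, (∀ x ∈ s, m ≤ x) → ‖∑ x ∈ s, T.toFun (x - m) (f x)‖ ^ 2 ≤
      (∑ x ∈ s, ∑ y ∈ s, inner ℂ (T.toFun (x - y) (f x)) (T.toFun (y - x) (f y))).re := by
  induction s using Finset.induction_on_min with
  | empty => simp
  | insert a s ha ih =>
    intro m hm
    have has : a ∉ s := fun h => (ha a h).false
    have hma : m ≤ a := hm a (Finset.mem_insert_self _ _)
    have ih' := ih a fun x hx => (ha x hx).le
    set v := ∑ x ∈ s, T.toFun (x - a) (f x)
    -- The new point `a` is the minimum, so `T(a - m)` factors out of the whole sum and can be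
    -- dropped as a contraction. The terms `e2`, `e3` are then the cross terms of `‖f a + v‖²`, and
    -- induction at `m = a` bounds `‖v‖²`.
    have e1 : ∑ x ∈ insert a s, T.toFun (x - m) (f x) = T.toFun (a - m) (f a + v) := by
      rw [Finset.sum_insert has, _root_.map_add, map_sum]
      refine congr_arg _ (Finset.sum_congr rfl fun x hx => ?_)
      rw [← tsub_add_tsub_cancel (ha x hx).le hma, add_comm, T.map_add]
      rfl
    have e2 : ∑ y ∈ s, inner ℂ (T.toFun (a - y) (f a)) (T.toFun (y - a) (f y))
        = inner ℂ (f a) v := by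
      rw [inner_sum]
      refine Finset.sum_congr rfl fun y hy => ?_
      rw [tsub_eq_zero_of_le (ha y hy).le, T.map_zero]
      rfl
    have e3 : ∑ x ∈ s, inner ℂ (T.toFun (x - a) (f x)) (T.toFun (a - x) (f a))
        = inner ℂ v (f a) := by
      rw [sum_inner]
      refine Finset.sum_congr rfl fun y hy => ?_
      rw [tsub_eq_zero_of_le (ha y hy).le, T.map_zero]
      rfl
    have e4 : inner ℂ (T.toFun (a - a) (f a)) (T.toFun (a - a) (f a)) = inner ℂ (f a) (f a) := by
      rw [tsub_self, T.map_zero]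
      rfl
    rw [e1]
    refine (pow_le_pow_left₀ (norm_nonneg _) (T.norm_apply_le _ _) 2).trans ?_
    simp only [Finset.sum_insert has, Finset.sum_add_distrib, e2, e3, e4, Complex.add_re]
    have h1 := norm_add_sq (𝕜 := ℂ) (f a) v
    have h2 : (inner ℂ (f a) (f a)).re = ‖f a‖ ^ 2 := inner_self_eq_norm_sq (𝕜 := ℂ) (f a)
    have h3 : (inner ℂ v (f a)).re = (inner ℂ (f a) v).re := inner_re_symm (𝕜 := ℂ) v (f a)
    rw [RCLike.re_eq_complex_re] at h1
    linarith

theorem posSemidef_dilationKernel [CompleteSpace H] (T : ContractiveSemigroup M H) :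
    T.dilationKernel.PosSemidef := by
  have h := (RKHS.posSemidef_tfae (K := T.dilationKernel)).out 0 2
  refine h.2 ⟨?_, fun f => ?_⟩
  · ext1 s t
    simp [dilationKernel, ContinuousLinearMap.star_eq_adjoint]
  · simp only [inner_dilationKernel]
    exact (sq_nonneg _).trans (T.norm_sq_sum_le f f.support 0 fun x _ => zero_le)

end Dilation

universe u v

/-- Every contractive semigroup has an isometric dilation. -/
theorem exists_isometric_dilation {M : Type u} {H : Type v} [AddCommMonoid M] [LinearOrder M]
    [CanonicallyOrderedAdd M] [IsOrderedCancelAddMonoid M] [Sub M] [OrderedSub M]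
    [TopologicalSpace M] [ContinuousSub M] [ContinuousAdd M] [TopologicalSpace.SeparableSpace M]
    [NormedAddCommGroup H] [InnerProductSpace ℂ H] [CompleteSpace H]
    [TopologicalSpace.SeparableSpace H] (T : ContractiveSemigroup M H) :
    ∃ (K : Type (max u v)) (_ : NormedAddCommGroup K) (_ : InnerProductSpace ℂ K) (_ : CompleteSpace K)
      (_ : TopologicalSpace.SeparableSpace K) (W : ContractiveSemigroup M K) (J : H →ₗᵢ[ℂ] K),
      W ∈ isometric M K ∧
      ∀ t ξ η, inner ℂ (J η) (W.toFun t (J ξ)) = inner ℂ η (T.toFun t ξ) := by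
  have : Fact T.dilationKernel.PosSemidef := ⟨T.posSemidef_dilationKernel⟩
  let K := RKHS.OfKernel T.dilationKernel
  let k : M → H →L[ℂ] K := RKHS.kerFun K
  have hk : ∀ s t ξ η, inner ℂ (k s ξ) (k t η)
      = inner ℂ (T.toFun (s - t) ξ) (T.toFun (t - s) η) := fun s t ξ η => by
    rw [← inner_dilationKernel, ← RKHS.kernel_inner, RKHS.OfKernel.kernel_ofKernel]
  let e : M × H → K := fun p => k p.1 p.2
  have hd : Dense (Submodule.span ℂ (Set.range e) : Set K) := by
    rw [Submodule.dense_iff_topologicalClosure_eq_top, ← RKHS.kerFun_dense K]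
    congr 2
    ext x
    simp [e, k]
  have hkn : ∀ s ξ, ‖k s ξ‖ = ‖ξ‖ := fun s ξ => by
    rw [norm_eq_sqrt_re_inner (𝕜 := ℂ), hk, tsub_self, T.map_zero,
      norm_eq_sqrt_re_inner (𝕜 := ℂ) ξ]
    rfl
  have hkc : ∀ ξ, Continuous fun s => k s ξ := fun ξ => by
    rw [continuous_iff_continuousAt]
    intro s
    rw [ContinuousAt, tendsto_iff_norm_sub_tendsto_zero]
    have hsq : ∀ t, ‖k t ξ - k s ξ‖ = √(2 * ‖ξ‖ ^ 2 -
        2 * (inner ℂ (T.toFun (t - s) ξ) (T.toFun (s - t) ξ)).re) := fun t => by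
      rw [← hk, ← Real.sqrt_sq (norm_nonneg (k t ξ - k s ξ)), norm_sub_sq (𝕜 := ℂ), hkn, hkn]
      congr 1
      simp only [RCLike.re_eq_complex_re]
      ring
    simp only [hsq]
    have hcont : Continuous fun t => √(2 * ‖ξ‖ ^ 2 -
        2 * (inner ℂ (T.toFun (t - s) ξ) (T.toFun (s - t) ξ)).re) := by
      have h1 : Continuous fun t => T.toFun (t - s) ξ :=
        (T.strongly_continuous ξ).comp (by fun_prop)
      have h2 : Continuous fun t => T.toFun (s - t) ξ :=
        (T.strongly_continuous ξ).comp (by fun_prop)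
      have h3 := Complex.continuous_re.comp (h1.inner (𝕜 := ℂ) h2)
      exact (continuous_const.sub (continuous_const.mul h3)).sqrt
    simpa only [← hsq, sub_self, norm_zero] using hcont.tendsto s
  have hshift : ∀ t, ∃ W : K →L[ℂ] K, (∀ x, ‖W x‖ = ‖x‖) ∧ ∀ p : M × H, W (e p) = k (p.1 + t) p.2 :=
    -- The Gram matrix depends only on truncated differences, hence is invariant under translation
    -- by `t`.
    fun t => exists_isometry_of_inner_eq hd fun p q => by
      simp only [e, hk, add_tsub_add_eq_tsub_right]
  choose W hWn hWe using hshift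
  have hWk : ∀ t s ξ, W t (k s ξ) = k (s + t) ξ := fun t s ξ => hWe t (s, ξ)
  have hlip : ∀ t, LipschitzWith 1 (W t) := fun t =>
    (AddMonoidHomClass.isometry_of_norm (W t) (hWn t)).lipschitz
  let S : ContractiveSemigroup M K :=
    { toFun := W
      map_zero := by
        refine ContinuousLinearMap.ext_on hd ?_
        rintro _ ⟨p, rfl⟩
        simp [e, hWk]
      map_add := fun s t => by
        refine ContinuousLinearMap.ext_on hd ?_
        rintro _ ⟨p, rfl⟩
        simp [e, hWk, add_assoc, add_comm s t]
      norm_le_one := fun t => (W t).opNorm_le_bound zero_le_one fun x => by rw [one_mul, hWn]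
      strongly_continuous := fun x => by
        let P : Submodule ℂ K :=
          { carrier := {x | Continuous fun t => W t x}
            zero_mem' := by simp [continuous_const]
            add_mem' := fun {x y} hx hy => by
              simp only [Set.mem_ofPred_eq, _root_.map_add]
              exact Continuous.add hx hy
            smul_mem' := fun c x hx => by
              simp only [Set.mem_ofPred_eq, map_smul]
              exact Continuous.const_smul hx c }
        have hP : Submodule.span ℂ (Set.range e) ≤ P := by
          rw [Submodule.span_le]
          rintro _ ⟨p, rfl⟩
          change Continuous fun t => W t (e p)
          simp only [hWe]
          exact (hkc p.2).comp (by fun_prop)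
        exact (isClosed_setOf_continuous_apply hlip).closure_subset_iff.2 hP (hd x) }
  have hsep : TopologicalSpace.SeparableSpace K := by
    -- `K` is the closed span of a continuous image of the separable space `M × H`.
    have he : Continuous e := continuous_prod_of_continuous_lipschitzWith' e 1
      (fun s => (AddMonoidHomClass.isometry_of_norm (k s) (hkn s)).lipschitz) hkc
    have h1 := (TopologicalSpace.isSeparable_range he).span (R := ℂ)
    rw [← TopologicalSpace.isSeparable_closure, hd.closure_eq] at h1
    exact TopologicalSpace.isSeparable_univ_iff.1 h1
  refine ⟨K, inferInstance, inferInstance, inferInstance, hsep, S, ⟨k 0, hkn 0⟩, hWn, ?_⟩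
  intro t ξ η
  change inner ℂ (k 0 η) (W t (k 0 ξ)) = _
  rw [hWk, hk, zero_add, tsub_zero, zero_tsub, T.map_zero]
  rfl

end ContractiveSemigroup

/-! ### Unitaries agreeing with an isometry on finite sets -/

/-- Distinct orthonormal vectors are `√2` apart, so balls of radius `1/2` about them are disjoint.
-/
theorem Orthonormal.countable_of_separableSpace {E : Type*} [NormedAddCommGroup E]
    [InnerProductSpace ℂ E] [TopologicalSpace.SeparableSpace E] {w : Set E}
    (hw : Orthonormal ℂ ((↑) : w → E)) : w.Countable := by
  refine Set.PairwiseDisjoint.countable_of_isOpen (s := fun x => Metric.ball x (1 / 2))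
    (fun x hx y hy hxy => ?_) (fun _ _ => Metric.isOpen_ball)
    (fun x _ => ⟨x, Metric.mem_ball_self (by norm_num)⟩)
  refine Metric.ball_disjoint_ball ?_
  have h0 : inner ℂ x y = 0 := hw.2 (i := ⟨x, hx⟩) (j := ⟨y, hy⟩) fun h => hxy (congrArg Subtype.val h)
  have h1 := norm_sub_sq (𝕜 := ℂ) x y
  have hx1 : ‖x‖ = 1 := hw.1 ⟨x, hx⟩
  have hy1 : ‖y‖ = 1 := hw.1 ⟨y, hy⟩
  rw [h0, hx1, hy1, map_zero] at h1
  rw [dist_eq_norm]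
  nlinarith [norm_nonneg (x - y)]

/-- In a separable infinite-dimensional Hilbert space, every finite orthonormal family extends to a
countably infinite Hilbert basis. -/
theorem Orthonormal.exists_hilbertBasis_sum_nat {E : Type*} [NormedAddCommGroup E]
    [InnerProductSpace ℂ E] [CompleteSpace E] [TopologicalSpace.SeparableSpace E]
    (hE : ¬ FiniteDimensional ℂ E) {n : ℕ} {u : Fin n → E} (hu : Orthonormal ℂ u) :
    ∃ b : HilbertBasis (Fin n ⊕ ℕ) ℂ E, ∀ i, b (Sum.inl i) = u i := by
  classical
  obtain ⟨w, b, huw, hb⟩ := hu.toSubtypeRange.exists_hilbertBasis_extension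
  have hw : Orthonormal ℂ ((↑) : w → E) := hb ▸ b.orthonormal
  have hspan : (Submodule.span ℂ w).topologicalClosure = ⊤ := by
    simpa [hb] using b.dense_span
  have hinf : w.Infinite := fun hfin => hE <| by
    have := FiniteDimensional.span_of_finite ℂ hfin
    rw [(Submodule.closed_of_finiteDimensional _).submodule_topologicalClosure_eq] at hspan
    rw [hspan] at this
    exact Module.finite_def.2 (Submodule.fg_iff_finiteDimensional _ |>.2 this)
  have : Countable (w \ Set.range u : Set E) :=
    (hw.countable_of_separableSpace.mono Set.sdiff_subset).to_subtype
  have : Infinite (w \ Set.range u : Set E) :=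
    (hinf.sdiff (Set.finite_range u)).to_subtype
  obtain ⟨e⟩ := nonempty_equiv_of_countable (α := ℕ) (β := (w \ Set.range u : Set E))
  let f : Fin n ⊕ ℕ ≃ w := ((Equiv.ofInjective u hu.linearIndependent.injective).sumCongr e).trans
    (Equiv.Set.sumDiffSubset huw)
  have hv : Orthonormal ℂ fun i => (f i : E) := hw.comp f f.injective
  have hr : Set.range (fun i => (f i : E)) = w := by
    rw [← Function.comp_def, f.surjective.range_comp, Subtype.range_coe]
  refine ⟨HilbertBasis.mk hv (by rw [hr, hspan]), fun i => ?_⟩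
  rw [HilbertBasis.coe_mk]
  simp [f]

/-- An isometric embedding between separable infinite-dimensional Hilbert spaces agrees with a
unitary operator on each finite set of vectors. -/
theorem LinearIsometry.exists_linearIsometryEquiv_eqOn {H K : Type*} [NormedAddCommGroup H]
    [InnerProductSpace ℂ H] [CompleteSpace H] [TopologicalSpace.SeparableSpace H]
    [NormedAddCommGroup K] [InnerProductSpace ℂ K] [CompleteSpace K]
    [TopologicalSpace.SeparableSpace K] (hH : ¬ FiniteDimensional ℂ H) (J : H →ₗᵢ[ℂ] K)
    (s : Finset H) : ∃ U : H ≃ₗᵢ[ℂ] K, Set.EqOn U J s := by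
  have hK : ¬ FiniteDimensional ℂ K := fun h =>
    hH (FiniteDimensional.of_injective J.toLinearMap J.injective)
  let F := Submodule.span ℂ (s : Set H)
  let u := stdOrthonormalBasis ℂ F
  have hu : Orthonormal ℂ fun i => (u i : H) := u.orthonormal.comp_linearIsometry F.subtypeₗᵢ
  obtain ⟨b, hb⟩ := hu.exists_hilbertBasis_sum_nat hH
  obtain ⟨c, hc⟩ := (hu.comp_linearIsometry J).exists_hilbertBasis_sum_nat hK
  -- Both bases are indexed by `Fin n ⊕ ℕ`, and `J` matches their `Fin n` parts.
  let U : H ≃ₗᵢ[ℂ] K := b.repr.trans c.repr.symm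
  have hU : ∀ i, U (u i) = J (u i) := fun i => by
    change c.repr.symm (b.repr (u i)) = J (u i)
    rw [← hb i, HilbertBasis.repr_self, HilbertBasis.repr_symm_single, hc, Function.comp_apply, hb]
  refine ⟨U, fun x hx => ?_⟩
  have hxF : x ∈ F := Submodule.subset_span hx
  have hEq : U.toLinearEquiv.toLinearMap ∘ₗ F.subtype = J.toLinearMap ∘ₗ F.subtype :=
    u.toBasis.ext fun i => by simpa using hU i
  exact LinearMap.congr_fun hEq ⟨x, hxF⟩

/-! ### Density of the isometric semigroups -/

namespace ContractiveSemigroup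

section Density

/-- The conjugate `U⁻¹ W U` of a contractive semigroup by a unitary operator. -/
def conj {M H K : Type*} [AddMonoid M] [TopologicalSpace M] [NormedAddCommGroup H]
    [InnerProductSpace ℂ H] [NormedAddCommGroup K] [InnerProductSpace ℂ K]
    (W : ContractiveSemigroup M K) (U : H ≃ₗᵢ[ℂ] K) : ContractiveSemigroup M H where
  toFun t := (U.symm.toContinuousLinearEquiv : K →L[ℂ] H) ∘L W.toFun t ∘L
    (U.toContinuousLinearEquiv : H →L[ℂ] K)
  map_zero := by ext; simp [W.map_zero]
  map_add s t := by ext; simp [W.map_add]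
  norm_le_one t := ContinuousLinearMap.opNorm_le_bound _ zero_le_one fun ξ => by
    simpa using W.norm_apply_le t (U ξ)
  strongly_continuous ξ := U.symm.continuous.comp (W.strongly_continuous (U ξ))

theorem conj_apply {M H K : Type*} [AddMonoid M] [TopologicalSpace M] [NormedAddCommGroup H]
    [InnerProductSpace ℂ H] [NormedAddCommGroup K] [InnerProductSpace ℂ K]
    (W : ContractiveSemigroup M K) (U : H ≃ₗᵢ[ℂ] K) (t : M) (ξ : H) :
    (W.conj U).toFun t ξ = U.symm (W.toFun t (U ξ)) := rfl

variable {M H : Type*} [AddCommMonoid M] [LinearOrder M] [CanonicallyOrderedAdd M]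
  [IsOrderedCancelAddMonoid M] [Sub M] [OrderedSub M] [TopologicalSpace M] [ContinuousSub M]
  [ContinuousAdd M] [TopologicalSpace.SeparableSpace M] [NormedAddCommGroup H]
  [InnerProductSpace ℂ H] [CompleteSpace H] [TopologicalSpace.SeparableSpace H]

/-- The isometric semigroups are dense in the contractive ones. -/
theorem dense_isometric (hH : ¬ FiniteDimensional ℂ H) : Dense (isometric M H) := by
  intro T
  obtain ⟨K, _, _, _, _, W, J, hW, hJ⟩ := T.exists_isometric_dilation
  choose U hU using J.exists_linearIsometryEquiv_eqOn hH
  -- The net is indexed by finite sets of vectors: once `s` contains `ξ` and `η`, the coefficient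
  -- equals that of `T` exactly, at all times.
  refine mem_closure_of_tendsto (b := atTop) (f := fun s => W.conj (U s)) ?_
    (Eventually.of_forall fun s t ξ => ?_)
  · rw [tendsto_nhds_iff]
    intro ξ η C _ ε hε
    classical
    filter_upwards [eventually_ge_atTop {ξ, η}] with s hs t _
    have hξ : U s ξ = J ξ := hU s (hs (by simp))
    have hη : U s η = J η := hU s (hs (by simp))
    rw [sub_apply, inner_sub_right, conj_apply, ← hJ, ← LinearIsometryEquiv.inner_map_map (U s) η,
      LinearIsometryEquiv.apply_symm_apply, hξ, hη, sub_self, norm_zero]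
    exact hε
  · rw [conj_apply, LinearIsometryEquiv.norm_map, hW t, LinearIsometryEquiv.norm_map]

variable [WeaklyLocallyCompactSpace M] [SigmaCompactSpace M]

theorem baireSpace (hH : ¬ FiniteDimensional ℂ H) : BaireSpace (ContractiveSemigroup M H) := by
  have := isCompletelyPseudoMetrizableSpace_isometric (M := M) (H := H)
  exact IsInducing.subtypeVal.baireSpace_of_denseRange (dense_isometric hH).denseRange_val

theorem isChoquetSpace (hH : ¬ FiniteDimensional ℂ H) :
    IsChoquetSpace (ContractiveSemigroup M H) := by
  have := isCompletelyPseudoMetrizableSpace_isometric (M := M) (H := H)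
  exact IsInducing.subtypeVal.isChoquetSpace_of_denseRange (dense_isometric hH).denseRange_val

end Density

/-! ### Discrete time and the weak polynomial topology -/

section Discrete

variable {H : Type*} [NormedAddCommGroup H] [InnerProductSpace ℂ H]

theorem toFun_nat (T : ContractiveSemigroup ℕ H) (n : ℕ) : T.toFun n = T.toFun 1 ^ n := by
  induction n with
  | zero => rw [pow_zero, T.map_zero]
  | succ n ih => rw [T.map_add, ih, pow_succ]

variable (H) in
/-- A discrete-time contractive semigroup is determined by the contraction `T(1)`. -/
def generatorEquiv : ContractiveSemigroup ℕ H ≃ PWContraction H where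
  toFun T := ⟨T.toFun 1, T.norm_le_one 1⟩
  invFun A :=
    { toFun := fun n => A.toCLM ^ n
      map_zero := pow_zero _
      map_add := pow_add _
      norm_le_one := fun n => by
        induction n with
        | zero => exact ContinuousLinearMap.norm_id_le
        | succ n ih =>
          rw [pow_succ]
          exact (norm_mul_le _ _).trans (mul_le_one₀ ih (norm_nonneg _) A.norm_le_one)
      strongly_continuous := fun _ => continuous_of_discreteTopology }
  left_inv T := ContractiveSemigroup.ext (funext fun n => (T.toFun_nat n).symm)
  right_inv A := PWContraction.ext (pow_one _)

/-- Compact subsets of `ℕ` are finite, so uniform convergence on them is convergence at each `n`,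
where `T(n) = T(1)^n`. -/
theorem isInducing_generatorEquiv [CompleteSpace H] : IsInducing (generatorEquiv H) := by
  have key : ∀ (T₀ : ContractiveSemigroup ℕ H) (l : Filter (ContractiveSemigroup ℕ H)),
      Tendsto id l (𝓝 T₀) ↔ Tendsto (generatorEquiv H) l (𝓝 (generatorEquiv H T₀)) := by
    intro T₀ l
    rw [tendsto_nhds_iff, @nhds_induced _ _ (weakPolynomialTopology H) PWContraction.toCLM,
      tendsto_comap_iff, tendsto_weakPolynomialTopology_iff]
    simp only [ContinuousLinearMapWOT.tendsto_iff_forall_inner_apply_tendsto]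
    have hpow : ∀ (T : ContractiveSemigroup ℕ H) (n : ℕ),
        (generatorEquiv H T).toCLM ^ n = T.toFun n := fun T n => (T.toFun_nat n).symm
    simp only [Function.comp_def, hpow, id]
    constructor
    · intro h n ξ η
      rw [Metric.tendsto_nhds]
      intro ε hε
      filter_upwards [h ξ η {n} isCompact_singleton ε hε] with T hT
      have := hT n rfl
      rw [sub_apply, inner_sub_right] at this
      rwa [dist_eq_norm]
    · intro h ξ η K hK ε hε
      refine (eventually_all_finite hK.finite_of_discrete).2 fun n _ => ?_
      filter_upwards [Metric.tendsto_nhds.1 (h n ξ η) ε hε] with T hT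
      rw [dist_eq_norm] at hT
      rw [sub_apply, inner_sub_right]
      exact hT
  refine isInducing_iff_nhds.2 fun T => le_antisymm ?_ ?_
  · exact tendsto_iff_comap.1 ((key T _).1 tendsto_id)
  · exact tendsto_id'.1 ((key T _).2 tendsto_comap)

end Discrete

end ContractiveSemigroup

theorem mainTheorem1 (H : Type*) [NormedAddCommGroup H] [InnerProductSpace ℂ H] [CompleteSpace H]
    [TopologicalSpace.SeparableSpace H] (hH : ¬ FiniteDimensional ℂ H) :
    (BaireSpace (ContractiveSemigroup ℝ≥0 H) ∧ BaireSpace (ContractiveSemigroup ℕ H)) ∧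
    (IsChoquetSpace (ContractiveSemigroup ℝ≥0 H) ∧ IsChoquetSpace (ContractiveSemigroup ℕ H)) ∧
    BaireSpace (PWContraction H) := by
  have hN : BaireSpace (ContractiveSemigroup ℕ H) := ContractiveSemigroup.baireSpace hH
  exact ⟨⟨ContractiveSemigroup.baireSpace hH, hN⟩,
    ⟨ContractiveSemigroup.isChoquetSpace hH, ContractiveSemigroup.isChoquetSpace hH⟩,
    ((ContractiveSemigroup.generatorEquiv H).toHomeomorphOfIsInducing
      ContractiveSemigroup.isInducing_generatorEquiv).baireSpace⟩
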